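/- Let $a>0$ and $\bar b>0$ be real numbers and put $T=2\pi/\sqrt a$. Let $f,g:\mathbb R^3\to\mathbb R$, $(t,\theta,\dot\theta)\mapsto f(t,\theta,\dot\theta),\,g(t,\theta,\dot\theta)$, be smooth ($C^\infty$) functions that are $T$-periodic in the variable $t$, and suppose that $f(t,0,0)=0$ for all $t$. Suppose that there are constants $C_1,C_2$ such that for all $t\in\mathbb R$ $$\frac{\partial f}{\partial\theta}(t,0,0)=C_1,\qquad \frac{\partial f}{\partial\dot\theta}(t,0,0)=C_2,$$ and let $$V_1=\int_0^{2\pi/\sqrt a}\sin(\sqrt a\,t)\,g(t,0,0)\,dt,\qquad V_2=\int_0^{2\pi/\sqrt a}\cos(\sqrt a\,t)\,g(t,0,0)\,dt.$$ If $(C_1,C_2)\neq(0,\bar b)$ and $(V_1,V_2)\neq(0,0)$, then there is $\varepsilon_0>0$ such that for every $\varepsilon\in(0,\varepsilon_0)$ the perturbed damped pendulum with damping coefficient $b=\varepsilon\bar b$, $$\ddot\theta=-a\sin\theta-\varepsilon\bar b\,\dot\theta+\varepsilon f(t,\theta,\dot\theta)+\varepsilon^2 g(t,\theta,\dot\theta),$$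 has a $2\pi/\sqrt a$-periodic solution $\theta(t,\varepsilon)$, $t\in\mathbb R$, and these solutions can be chosen so that $(\theta(0,\varepsilon),\dot\theta(0,\varepsilon))\to(0,0)$ as $\varepsilon\to0^+$. -/

import Mathlib

open Filter Topology
open scoped ContDiff

/-- A function of `(t, θ, θ')` is smooth, i.e. jointly of class `C^∞` on `ℝ³`. -/
def IsSmoothForcing (f : ℝ → ℝ → ℝ → ℝ) : Prop :=
  ContDiff ℝ ∞ (fun q : ℝ × ℝ × ℝ => f q.1 q.2.1 q.2.2)

/-- `θ : ℝ → ℝ` is a (global, twice differentiable) solution of the perturbed damped pendulum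
`θ'' = -a sin θ - b θ' + ε f(t, θ, θ') + ε² g(t, θ, θ')`. -/
def IsPerturbedPendulumSolution (a b ε : ℝ) (f g : ℝ → ℝ → ℝ → ℝ) (θ : ℝ → ℝ) : Prop :=
  Differentiable ℝ θ ∧
    ∀ t : ℝ, HasDerivAt (deriv θ)
      (-a * Real.sin (θ t) - b * deriv θ t + ε * f t (θ t) (deriv θ t)
        + ε ^ 2 * g t (θ t) (deriv θ t)) t

/-!
Set `ν = √a` and `T = 2π/ν`. The substitution `θ = ε u` turns the pendulum equation into a small
perturbation of the harmonic oscillator, `u'' = -ν² u + ε F(ε, t, u, u')`, where `F` equals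
`C₁ u + (C₂ - b) u' + g(t, 0, 0)` up to a term vanishing at `u = u' = 0` whose Lipschitz constant on
bounded sets tends to `0` with `ε` (`eventually_rescaledForce_sub_le`). In the rotating coordinate
`z`, given by `u = Re (z e^{-iνt})`, `u' = ν Im (z e^{-iνt})`, the equation becomes the slow system
`z' = ε (i/ν) e^{iνt} F`. The mean over a period of its linear part is multiplication by
`((C₂ - b) + i C₁/ν) / 2` (`integral_amplitudeOperator`), which is invertible exactly when
`(C₁, C₂) ≠ (0, b)`.

Invertibility of the averaged linear part yields periodic solutions of the slow system in a ball
independent of `ε`. Let `L` be the integral over `[0, T]` of the linear part. A periodic solution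
`z = z₀ + μ w` of `z' = ε G(t, z)` is a fixed point of
`(z₀, w) ↦ (z₀ - L⁻¹ ∫₀ᵀ G, (ε/μ) (∫₀ᵗ G - (t/T) ∫₀ᵀ G))`
on the product of the phase space with the continuous functions on the circle `ℝ / Tℤ`. The first
component forces the mean of `G` along `z` to vanish, after which the second one is the differential
equation. If `μ` is small and then `ε` is small, this map is a contraction
(`exists_periodic_solution_of_bounds`), so no Poincaré map or smooth dependence on parameters is
needed. Boundedness of `z` makes `θ = ε u` and `θ' = ε u'` tend to `0`.
-/

/-! ### A contraction on a ball around the origin -/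

/-- Contraction principle on a ball: a `1/2`-Lipschitz map moving the centre by at most half the
radius preserves the ball. -/
theorem exists_fixedPoint_of_norm_sub_le_half {X : Type*} [NormedAddCommGroup X] [CompleteSpace X]
    (Φ : X → X) {ρ : ℝ} (hρ : 0 ≤ ρ) (h0 : ‖Φ 0‖ ≤ ρ / 2)
    (hΦ : ∀ x y, ‖x‖ ≤ ρ → ‖y‖ ≤ ρ → ‖Φ x - Φ y‖ ≤ 1 / 2 * ‖x - y‖) :
    ∃ x, ‖x‖ ≤ ρ ∧ Φ x = x := by
  have hmaps : Set.MapsTo Φ (Metric.closedBall 0 ρ) (Metric.closedBall 0 ρ) := by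
    intro x hx
    rw [mem_closedBall_zero_iff] at hx ⊢
    have h1 := hΦ x 0 hx (by simpa using hρ)
    have h2 := norm_le_norm_sub_add (Φ x) (Φ 0)
    rw [sub_zero] at h1
    linarith
  have hcontr : ContractingWith (1 / 2) (hmaps.restrict Φ _ _) := by
    refine ⟨by norm_num, LipschitzWith.of_dist_le_mul fun x y => ?_⟩
    have := hΦ x y (mem_closedBall_zero_iff.1 x.2) (mem_closedBall_zero_iff.1 y.2)
    simpa [Subtype.dist_eq, dist_eq_norm] using this
  obtain ⟨x, hx, hfix, -⟩ := hcontr.exists_fixedPoint' Metric.isClosed_closedBall.isComplete hmaps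
    (Metric.mem_closedBall_self hρ) (edist_ne_top _ _)
  exact ⟨x, by simpa using hx, hfix⟩

/-! ### The periodic primitive of a periodic function -/

section PeriodicPrimitive

variable {E : Type*} [NormedAddCommGroup E] [NormedSpace ℝ E] {T : ℝ}

/-- The primitive vanishing at `0` of `γ` minus its mean over `[0, T]`; subtracting the mean is what
makes the primitive of a `T`-periodic `γ` again `T`-periodic. -/
noncomputable def centeredPrimitive (T : ℝ) (γ : ℝ → E) (t : ℝ) : E :=
  (∫ s in (0 : ℝ)..t, γ s) - (t / T) • ∫ s in (0 : ℝ)..T, γ s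

theorem continuous_centeredPrimitive {γ : ℝ → E} (hγ : Continuous γ) :
    Continuous (centeredPrimitive T γ) := by
  unfold centeredPrimitive
  have := intervalIntegral.continuous_primitive (μ := MeasureTheory.volume)
    (fun a b => hγ.intervalIntegrable a b) 0
  fun_prop

theorem periodic_centeredPrimitive (hT : 0 < T) {γ : ℝ → E} (hγ : Continuous γ)
    (hper : Function.Periodic γ T) : Function.Periodic (centeredPrimitive T γ) T := by
  intro t
  have h := intervalIntegral.integral_add_adjacent_intervals
    (hγ.intervalIntegrable (μ := MeasureTheory.volume) 0 t) (hγ.intervalIntegrable t (t + T))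
  have h2 := hper.intervalIntegral_add_eq t 0
  rw [zero_add] at h2
  simp only [centeredPrimitive]
  rw [← h, h2, add_div, div_self hT.ne', add_smul, one_smul]
  abel

theorem centeredPrimitive_sub {γ δ : ℝ → E} (hγ : Continuous γ) (hδ : Continuous δ) (t : ℝ) :
    centeredPrimitive T γ t - centeredPrimitive T δ t =
      centeredPrimitive T (fun s => γ s - δ s) t := by
  simp only [centeredPrimitive]
  rw [intervalIntegral.integral_sub (hγ.intervalIntegrable _ _) (hδ.intervalIntegrable _ _),
    intervalIntegral.integral_sub (hγ.intervalIntegrable _ _) (hδ.intervalIntegrable _ _), smul_sub]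
  abel

theorem norm_integral_le_of_norm_le_Icc (hT : 0 < T) {γ : ℝ → E} {B : ℝ}
    (hB : ∀ s ∈ Set.Icc 0 T, ‖γ s‖ ≤ B) {t : ℝ} (ht : t ∈ Set.Icc 0 T) :
    ‖∫ s in (0 : ℝ)..t, γ s‖ ≤ T * B := by
  have hB0 : 0 ≤ B := (norm_nonneg _).trans (hB 0 ⟨le_rfl, hT.le⟩)
  refine (intervalIntegral.norm_integral_le_of_norm_le_const (C := B) fun s hs => ?_).trans ?_
  · rw [Set.uIoc_of_le ht.1] at hs
    exact hB s ⟨hs.1.le, hs.2.trans ht.2⟩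
  · rw [sub_zero, abs_of_nonneg ht.1, mul_comm]
    exact mul_le_mul_of_nonneg_right ht.2 hB0

theorem norm_centeredPrimitive_le (hT : 0 < T) {γ : ℝ → E} {B : ℝ}
    (hB : ∀ s ∈ Set.Icc 0 T, ‖γ s‖ ≤ B) {t : ℝ} (ht : t ∈ Set.Icc 0 T) :
    ‖centeredPrimitive T γ t‖ ≤ 2 * T * B := by
  have h1 := norm_integral_le_of_norm_le_Icc hT hB ht
  have h2 := norm_integral_le_of_norm_le_Icc hT hB (t := T) ⟨hT.le, le_rfl⟩
  have h3 : ‖(t / T) • ∫ s in (0 : ℝ)..T, γ s‖ ≤ ‖∫ s in (0 : ℝ)..T, γ s‖ := by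
    rw [norm_smul, Real.norm_of_nonneg (div_nonneg ht.1 hT.le)]
    exact mul_le_of_le_one_left (norm_nonneg _) ((div_le_one hT).2 ht.2)
  have h4 := norm_sub_le (∫ s in (0 : ℝ)..t, γ s) ((t / T) • ∫ s in (0 : ℝ)..T, γ s)
  simp only [centeredPrimitive]
  linarith

/-- The continuous function on the circle `ℝ / Tℤ` induced by a continuous `T`-periodic function. -/
def circleLift (γ : ℝ → E) (hγ : Continuous γ) (hper : Function.Periodic γ T) :
    C(AddCircle T, E) where
  toFun := hper.lift
  continuous_toFun := hγ.quotient_lift _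

omit [NormedSpace ℝ E] in
theorem circleLift_coe (γ : ℝ → E) (hγ : Continuous γ) (hper : Function.Periodic γ T) (t : ℝ) :
    circleLift γ hγ hper (t : AddCircle T) = γ t := rfl

omit [NormedSpace ℝ E] in
theorem norm_circle_le (hT : 0 < T) [Fact (0 < T)] {γ : C(AddCircle T, E)} {B : ℝ}
    (hB : ∀ s ∈ Set.Icc 0 T, ‖γ (s : AddCircle T)‖ ≤ B) : ‖γ‖ ≤ B := by
  refine (ContinuousMap.norm_le _ ((norm_nonneg _).trans (hB 0 ⟨le_rfl, hT.le⟩))).2 fun x => ?_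
  have hx : x ∈ ((↑) : ℝ → AddCircle T) '' Set.Icc 0 (0 + T) := by
    rw [AddCircle.coe_image_Icc_eq]; trivial
  obtain ⟨s, hs, rfl⟩ := hx
  exact hB s (by simpa using hs)

end PeriodicPrimitive

/-! ### Periodic solutions of slowly varying systems -/

section Averaging

variable {E : Type*} [NormedAddCommGroup E] [NormedSpace ℝ E] [CompleteSpace E] {T : ℝ}

/-- Existence of a periodic solution of `z' = ε G(t, z)` for one value of `ε`, under explicit
smallness conditions: `h1` and `h2` make the two components of the fixed-point map
`1/2`-Lipschitz, `h3` and `h4` bound its value at the origin. -/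
theorem exists_periodic_solution_of_bounds (hT : 0 < T) {A : ℝ → E →L[ℝ] E} (hA : Continuous A)
    (L : E ≃L[ℝ] E) (hL : ∀ z, ∫ t in (0 : ℝ)..T, A t z = L z)
    {G : ℝ → E → E} (hG : Continuous (Function.uncurry G)) (hper : ∀ t z, G (t + T) z = G t z)
    {K H η ρ ε μ : ℝ} (hK : ∀ t ∈ Set.Icc 0 T, ‖A t‖ ≤ K) (hH : ∀ t ∈ Set.Icc 0 T, ‖G t 0‖ ≤ H)
    (hη : 0 ≤ η) (hρ : 0 ≤ ρ) (hε : 0 ≤ ε) (hμ0 : 0 < μ) (hμ1 : μ ≤ 1)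
    (hlip : ∀ t ∈ Set.Icc 0 T, ∀ z z', ‖z‖ ≤ 2 * ρ → ‖z'‖ ≤ 2 * ρ →
      ‖G t z - G t z' - A t (z - z')‖ ≤ η * ‖z - z'‖)
    (h1 : ‖(L.symm : E →L[ℝ] E)‖ * (T * (μ * K + 2 * η)) ≤ 1 / 2)
    (h2 : ε / μ * (2 * T * ((K + η) * 2)) ≤ 1 / 2)
    (h3 : ‖L.symm (∫ t in (0 : ℝ)..T, G t 0)‖ ≤ ρ / 2)
    (h4 : ε / μ * (2 * T * H) ≤ ρ / 2) :
    ∃ z : ℝ → E, (∀ t, HasDerivAt z (ε • G t (z t)) t) ∧ Function.Periodic z T ∧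
      ∀ t, ‖z t‖ ≤ 2 * ρ := by
  have : Fact (0 < T) := ⟨hT⟩
  -- A point `(z₀, w)` encodes the periodic function `z₀ + μ w`.
  let Z : E × C(AddCircle T, E) → ℝ → E := fun p t => p.1 + μ • p.2 (t : AddCircle T)
  have hZc : ∀ p, Continuous (Z p) := fun p =>
    continuous_const.add ((p.2.continuous.comp (AddCircle.continuous_mk' T)).const_smul μ)
  have hZp : ∀ p, Function.Periodic (Z p) T := fun p t => by
    simp only [Z, AddCircle.coe_add_period]
  have hZsub : ∀ p q t, Z p t - Z q t = (p - q).1 + μ • (p - q).2 (t : AddCircle T) := by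
    intro p q t
    simp only [Z, Prod.fst_sub, Prod.snd_sub, ContinuousMap.sub_apply, smul_sub]
    abel
  have hw : ∀ p : E × C(AddCircle T, E), ∀ t : AddCircle T, ‖μ • p.2 t‖ ≤ μ * ‖p‖ := by
    intro p t
    rw [norm_smul, Real.norm_of_nonneg hμ0.le]
    exact mul_le_mul_of_nonneg_left ((p.2.norm_coe_le_norm t).trans (norm_snd_le p)) hμ0.le
  have hZn : ∀ p : E × C(AddCircle T, E), ∀ t : AddCircle T, ‖p.1 + μ • p.2 t‖ ≤ 2 * ‖p‖ := by
    intro p t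
    have := norm_add_le p.1 (μ • p.2 t)
    have := hw p t
    have := norm_fst_le p
    have := mul_le_of_le_one_left (norm_nonneg p) hμ1
    linarith
  let γ : E × C(AddCircle T, E) → ℝ → E := fun p t => G t (Z p t)
  have hγc : ∀ p, Continuous (γ p) := fun p => hG.comp (continuous_id.prodMk (hZc p))
  have hγp : ∀ p, Function.Periodic (γ p) T := fun p t => by
    simp only [γ, hZp p t, hper]
  let W : E × C(AddCircle T, E) → C(AddCircle T, E) := fun p =>
    circleLift (centeredPrimitive T (γ p)) (continuous_centeredPrimitive (hγc p))
      (periodic_centeredPrimitive hT (hγc p) (hγp p))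
  let Φ : E × C(AddCircle T, E) → E × C(AddCircle T, E) := fun p =>
    (p.1 - L.symm (∫ t in (0 : ℝ)..T, γ p t), (ε / μ) • W p)
  have hγ0 : γ 0 = fun t => G t 0 := by
    funext t; simp [γ, Z]
  have hεμ : 0 ≤ ε / μ := div_nonneg hε hμ0.le
  have hΦ0 : ‖Φ 0‖ ≤ ρ / 2 := by
    refine norm_prod_le_iff.2 ⟨?_, ?_⟩
    · simpa [Φ, hγ0] using h3
    · simp only [Φ]
      rw [norm_smul, Real.norm_of_nonneg hεμ]
      refine (mul_le_mul_of_nonneg_left ?_ hεμ).trans h4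
      refine norm_circle_le hT fun s hs => norm_centeredPrimitive_le hT (fun r hr => ?_) hs
      rw [hγ0]; exact hH r hr
  have hΦlip : ∀ p q, ‖p‖ ≤ ρ → ‖q‖ ≤ ρ → ‖Φ p - Φ q‖ ≤ 1 / 2 * ‖p - q‖ := by
    intro p q hp hq
    have hZpq : ∀ t, ‖Z p t - Z q t‖ ≤ 2 * ‖p - q‖ := fun t => by
      rw [hZsub]; exact hZn _ _
    have hlip' : ∀ t ∈ Set.Icc 0 T, ‖γ p t - γ q t - A t (Z p t - Z q t)‖ ≤ η * (2 * ‖p - q‖) :=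
      fun t ht => (hlip t ht _ _ ((hZn p t).trans (by linarith))
        ((hZn q t).trans (by linarith))).trans (mul_le_mul_of_nonneg_left (hZpq t) hη)
    refine norm_prod_le_iff.2 ⟨?_, ?_⟩
    · -- `L` is the integral of `A`, so the part of the integrand linear in `z₀` cancels.
      have hAc : Continuous fun t => A t (p - q).1 := by fun_prop
      have key : (Φ p - Φ q).1 =
          -L.symm (∫ t in (0 : ℝ)..T, (γ p t - γ q t - A t (p - q).1)) := by
        have hγpq : Continuous fun t => γ p t - γ q t := (hγc p).sub (hγc q)
        rw [intervalIntegral.integral_sub (hγpq.intervalIntegrable _ _)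
            (hAc.intervalIntegrable _ _),
          intervalIntegral.integral_sub ((hγc p).intervalIntegrable _ _)
            ((hγc q).intervalIntegrable _ _), hL, map_sub, map_sub, L.symm_apply_apply]
        simp only [Φ, Prod.fst_sub]
        abel
      rw [key, norm_neg]
      have hint : ‖∫ t in (0 : ℝ)..T, (γ p t - γ q t - A t (p - q).1)‖ ≤
          T * ((μ * K + 2 * η) * ‖p - q‖) := by
        refine norm_integral_le_of_norm_le_Icc hT (fun t ht => ?_) ⟨hT.le, le_rfl⟩
        have hsplit : γ p t - γ q t - A t (p - q).1 =
            (γ p t - γ q t - A t (Z p t - Z q t)) + A t (μ • (p - q).2 (t : AddCircle T)) := by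
          rw [hZsub, map_add]; abel
        have hAw : ‖A t (μ • (p - q).2 (t : AddCircle T))‖ ≤ K * (μ * ‖p - q‖) :=
          (A t).le_of_opNorm_le_of_le (hK t ht) (hw _ _)
        rw [hsplit]
        refine (norm_add_le _ _).trans ((add_le_add (hlip' t ht) hAw).trans (le_of_eq ?_))
        ring
      calc ‖L.symm (∫ t in (0 : ℝ)..T, (γ p t - γ q t - A t (p - q).1))‖
          ≤ ‖(L.symm : E →L[ℝ] E)‖ * (T * ((μ * K + 2 * η) * ‖p - q‖)) :=
            (L.symm : E →L[ℝ] E).le_opNorm_of_le hint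
        _ = ‖(L.symm : E →L[ℝ] E)‖ * (T * (μ * K + 2 * η)) * ‖p - q‖ := by ring
        _ ≤ 1 / 2 * ‖p - q‖ := mul_le_mul_of_nonneg_right h1 (norm_nonneg _)
    · have hsnd : (Φ p - Φ q).2 = (ε / μ) • (W p - W q) := by
        simp only [Φ, Prod.snd_sub, smul_sub]
      have hWsub : ‖W p - W q‖ ≤ 2 * T * ((K + η) * (2 * ‖p - q‖)) := by
        refine norm_circle_le hT fun s hs => ?_
        rw [ContinuousMap.sub_apply, circleLift_coe, circleLift_coe,
          centeredPrimitive_sub (hγc p) (hγc q)]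
        refine norm_centeredPrimitive_le hT (fun t ht => ?_) hs
        have hAz : ‖A t (Z p t - Z q t)‖ ≤ K * (2 * ‖p - q‖) :=
          (A t).le_of_opNorm_le_of_le (hK t ht) (hZpq t)
        have := norm_le_norm_sub_add (γ p t - γ q t) (A t (Z p t - Z q t))
        linarith [hlip' t ht]
      rw [hsnd, norm_smul, Real.norm_of_nonneg hεμ]
      calc ε / μ * ‖W p - W q‖ ≤ ε / μ * (2 * T * ((K + η) * (2 * ‖p - q‖))) :=
            mul_le_mul_of_nonneg_left hWsub hεμ
        _ = ε / μ * (2 * T * ((K + η) * 2)) * ‖p - q‖ := by ring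
        _ ≤ 1 / 2 * ‖p - q‖ := mul_le_mul_of_nonneg_right h2 (norm_nonneg _)
  obtain ⟨p, hp, hfix⟩ := exists_fixedPoint_of_norm_sub_le_half Φ hρ hΦ0 hΦlip
  have hfix1 : ∫ t in (0 : ℝ)..T, γ p t = 0 := by
    have : p.1 - L.symm (∫ t in (0 : ℝ)..T, γ p t) = p.1 := congrArg Prod.fst hfix
    simpa using this
  have hfix2 : ∀ t : ℝ, p.2 (t : AddCircle T) = (ε / μ) • ∫ s in (0 : ℝ)..t, γ p s := by
    intro t
    have h : (ε / μ) • W p = p.2 := congrArg Prod.snd hfix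
    rw [← h, ContinuousMap.smul_apply, circleLift_coe, centeredPrimitive, hfix1, smul_zero,
      sub_zero]
  have hZeq : Z p = fun t => p.1 + ε • ∫ s in (0 : ℝ)..t, γ p s := by
    funext t
    simp only [Z, hfix2, smul_smul, mul_div_cancel₀ ε hμ0.ne']
  refine ⟨Z p, fun t => ?_, hZp p, fun t => (hZn p t).trans (by linarith)⟩
  have hd : HasDerivAt (fun t => p.1 + ε • ∫ s in (0 : ℝ)..t, γ p s) (ε • γ p t) t :=
    (((hγc p).integral_hasStrictDerivAt 0 t).hasDerivAt.const_smul ε).const_add p.1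
  rw [← hZeq] at hd
  exact hd

/-- First-order averaging, affine case: if `G ε t z` is `h t + A t z` up to a perturbation vanishing
at `0` with Lipschitz constant `o(1)` on the ball of radius `M`, and the integral `L` of `A` over a
period is invertible, then `z' = ε G ε t z` has a periodic solution in that ball for all small
`ε > 0`. The radius `M` depends only on `h` and `L`, so it may be used to verify the hypotheses
on `G`. -/
theorem eventually_exists_periodic_solution (hT : 0 < T) {A : ℝ → E →L[ℝ] E} (hA : Continuous A)
    {h : ℝ → E} (hh : Continuous h) (L : E ≃L[ℝ] E)
    (hL : ∀ z, ∫ t in (0 : ℝ)..T, A t z = L z) :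
    ∃ M : ℝ, ∀ G : ℝ → ℝ → E → E, (∀ ε, Continuous (Function.uncurry (G ε))) →
      (∀ ε t z, G ε (t + T) z = G ε t z) → (∀ ε t, G ε t 0 = h t) →
      (∀ η > 0, ∀ᶠ ε in 𝓝[>] (0 : ℝ), ∀ t ∈ Set.Icc 0 T, ∀ z z', ‖z‖ ≤ M → ‖z'‖ ≤ M →
        ‖G ε t z - G ε t z' - A t (z - z')‖ ≤ η * ‖z - z'‖) →
      ∀ᶠ ε in 𝓝[>] (0 : ℝ), ∃ z : ℝ → E, (∀ t, HasDerivAt z (ε • G ε t (z t)) t) ∧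
        Function.Periodic z T ∧ ∀ t, ‖z t‖ ≤ M := by
  obtain ⟨K, hK⟩ := isCompact_Icc.exists_bound_of_continuousOn (s := Set.Icc 0 T) hA.continuousOn
  obtain ⟨H, hH⟩ := isCompact_Icc.exists_bound_of_continuousOn (s := Set.Icc 0 T) hh.continuousOn
  set ℓ := ‖(L.symm : E →L[ℝ] E)‖
  set ρ := 2 * ‖L.symm (∫ t in (0 : ℝ)..T, h t)‖ + 1 with hρdef
  have hρ : 0 < ρ := by positivity
  refine ⟨2 * ρ, fun G hG hper hG0 hlip => ?_⟩
  -- `μ` is fixed first, then `η`, so that `ℓ T μ K` and `2 ℓ T η` are each less than `1 / 4`.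
  have hlim1 : Tendsto (fun μ => ℓ * (T * (μ * K))) (𝓝[>] (0 : ℝ)) (𝓝 0) :=
    tendsto_nhdsWithin_of_tendsto_nhds
      ((by fun_prop : Continuous fun μ => ℓ * (T * (μ * K))).tendsto' 0 0 (by simp))
  have hlim2 : Tendsto (fun η => ℓ * (T * (2 * η))) (𝓝[>] (0 : ℝ)) (𝓝 0) :=
    tendsto_nhdsWithin_of_tendsto_nhds
      ((by fun_prop : Continuous fun η => ℓ * (T * (2 * η))).tendsto' 0 0 (by simp))
  obtain ⟨μ, hμ, hμ0, hμ1⟩ := ((hlim1.eventually_lt_const (by norm_num : (0 : ℝ) < 1 / 4)).and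
    (Ioc_mem_nhdsGT one_pos)).exists
  obtain ⟨η, hη, hη0⟩ := ((hlim2.eventually_lt_const (by norm_num : (0 : ℝ) < 1 / 4)).and
    self_mem_nhdsWithin).exists
  have hlim3 : Tendsto (fun ε => ε / μ * (2 * T * ((K + η) * 2))) (𝓝[>] (0 : ℝ)) (𝓝 0) :=
    tendsto_nhdsWithin_of_tendsto_nhds
      ((by fun_prop : Continuous fun ε => ε / μ * (2 * T * ((K + η) * 2))).tendsto' 0 0 (by simp))
  have hlim4 : Tendsto (fun ε => ε / μ * (2 * T * H)) (𝓝[>] (0 : ℝ)) (𝓝 0) :=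
    tendsto_nhdsWithin_of_tendsto_nhds
      ((by fun_prop : Continuous fun ε => ε / μ * (2 * T * H)).tendsto' 0 0 (by simp))
  filter_upwards [hlip η hη0, hlim3.eventually_lt_const (by norm_num : (0 : ℝ) < 1 / 2),
    hlim4.eventually_lt_const (half_pos hρ), self_mem_nhdsWithin] with ε hε hε2 hε4 hε0
  refine exists_periodic_solution_of_bounds hT hA L hL (hG ε) (hper ε) (H := H) (μ := μ) hK
    (fun t ht => by rw [hG0]; exact hH t ht) (le_of_lt hη0) hρ.le (le_of_lt hε0) hμ0 hμ1 hε
    ?_ hε2.le ?_ hε4.le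
  · rw [mul_add T, mul_add ℓ]; linarith
  · simp only [hG0]; linarith

end Averaging

/-! ### Lipschitz estimates for the forcing terms near the origin -/

section Estimates

variable {T : ℝ}

theorem IsSmoothForcing.contDiff_uncurry {f : ℝ → ℝ → ℝ → ℝ} (hf : IsSmoothForcing f) :
    ContDiff ℝ ∞ (Function.uncurry fun (t : ℝ) (p : ℝ × ℝ) => f t p.1 p.2) := hf

theorem IsSmoothForcing.differentiable {f : ℝ → ℝ → ℝ → ℝ} (hf : IsSmoothForcing f) (t : ℝ) :
    Differentiable ℝ fun p : ℝ × ℝ => f t p.1 p.2 :=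
  (hf.contDiff_uncurry.differentiable (by simp)).comp
    ((differentiable_const t).prodMk differentiable_id)

theorem IsSmoothForcing.continuous_fderiv {f : ℝ → ℝ → ℝ → ℝ} (hf : IsSmoothForcing f) :
    Continuous fun q : ℝ × (ℝ × ℝ) => fderiv ℝ (fun p : ℝ × ℝ => f q.1 p.1 p.2) q.2 :=
  (ContDiff.fderiv (n := 0) (f := fun (q : ℝ × (ℝ × ℝ)) (p : ℝ × ℝ) => f q.1 p.1 p.2)
    (g := Prod.snd)
    (hf.comp (by fun_prop : ContDiff ℝ ∞ fun r : (ℝ × (ℝ × ℝ)) × (ℝ × ℝ) => (r.1.1, r.2)))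
    contDiff_snd (by simp)).continuous

theorem IsSmoothForcing.fderiv_zero_apply {f : ℝ → ℝ → ℝ → ℝ} (hf : IsSmoothForcing f) (t : ℝ)
    (p : ℝ × ℝ) : fderiv ℝ (fun p : ℝ × ℝ => f t p.1 p.2) 0 p =
      deriv (fun x => f t x 0) 0 * p.1 + deriv (fun y => f t 0 y) 0 * p.2 := by
  have hd := (hf.differentiable t 0).hasFDerivAt
  have h1 : HasDerivAt (fun x => f t x 0)
      (fderiv ℝ (fun p : ℝ × ℝ => f t p.1 p.2) 0 (1, 0)) 0 :=
    HasFDerivAt.comp_hasDerivAt (f := fun x : ℝ => (x, (0 : ℝ))) 0 hd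
      ((hasDerivAt_id 0).prodMk (hasDerivAt_const 0 0))
  have h2 : HasDerivAt (fun y => f t 0 y)
      (fderiv ℝ (fun p : ℝ × ℝ => f t p.1 p.2) 0 (0, 1)) 0 :=
    HasFDerivAt.comp_hasDerivAt (f := fun y : ℝ => ((0 : ℝ), y)) 0 hd
      ((hasDerivAt_const 0 0).prodMk (hasDerivAt_id 0))
  rw [h1.deriv, h2.deriv]
  have hp : p = p.1 • ((1, 0) : ℝ × ℝ) + p.2 • ((0, 1) : ℝ × ℝ) := by ext <;> simp
  conv_lhs => rw [hp, map_add, map_smul, map_smul]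
  simp only [smul_eq_mul]
  ring

/-- Near the origin `f(t, ·)` differs from its linearization, assumed independent of `t`, by a
function with small Lipschitz constant, uniformly in `t ∈ [0, T]` by compactness. -/
theorem IsSmoothForcing.exists_norm_sub_sub_le {f : ℝ → ℝ → ℝ → ℝ} (hf : IsSmoothForcing f)
    {C₁ C₂ : ℝ} (hC₁ : ∀ t : ℝ, deriv (fun x : ℝ => f t x 0) 0 = C₁)
    (hC₂ : ∀ t : ℝ, deriv (fun y : ℝ => f t 0 y) 0 = C₂) {η : ℝ} (hη : 0 < η) :
    ∃ δ > 0, ∀ t ∈ Set.Icc 0 T, ∀ p q : ℝ × ℝ, ‖p‖ < δ → ‖q‖ < δ →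
      |f t p.1 p.2 - f t q.1 q.2 - (C₁ * (p.1 - q.1) + C₂ * (p.2 - q.2))| ≤ η * ‖p - q‖ := by
  set Λ := fderiv ℝ (fun p : ℝ × ℝ => f 0 p.1 p.2) 0 with hΛ
  have hΛt : ∀ t, fderiv ℝ (fun p : ℝ × ℝ => f t p.1 p.2) 0 = Λ := by
    intro t
    ext1 <;> ext <;> simp [hΛ, hf.fderiv_zero_apply, hC₁, hC₂]
  have hev : ∀ᶠ p : ℝ × ℝ in 𝓝 0, ∀ t ∈ Set.Icc 0 T,
      ‖fderiv ℝ (fun p : ℝ × ℝ => f t p.1 p.2) p - Λ‖ < η := by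
    refine isCompact_Icc.eventually_forall_of_forall_eventually fun t _ => ?_
    have hc : Continuous fun r : (ℝ × ℝ) × ℝ =>
        ‖fderiv ℝ (fun p : ℝ × ℝ => f r.2 p.1 p.2) r.1 - Λ‖ :=
      ((hf.continuous_fderiv.comp continuous_swap).sub continuous_const).norm
    refine hc.continuousAt.eventually_lt_const ?_
    simpa [hΛt] using hη
  obtain ⟨δ, hδ, hball⟩ := Metric.eventually_nhds_iff_ball.1 hev
  refine ⟨δ, hδ, fun t ht p q hp hq => ?_⟩
  have := (convex_ball (0 : ℝ × ℝ) δ).norm_image_sub_le_of_norm_fderiv_le' (𝕜 := ℝ)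
    (f := fun p : ℝ × ℝ => f t p.1 p.2) (φ := Λ) (C := η)
    (fun x _ => hf.differentiable t x) (fun x hx => (hball x hx t ht).le)
    (mem_ball_zero_iff.2 hq) (mem_ball_zero_iff.2 hp)
  rwa [hΛ, hf.fderiv_zero_apply, hC₁, hC₂, Real.norm_eq_abs] at this

theorem IsSmoothForcing.exists_norm_sub_le {g : ℝ → ℝ → ℝ → ℝ} (hg : IsSmoothForcing g) :
    ∃ K : ℝ, ∀ t ∈ Set.Icc 0 T, ∀ p q : ℝ × ℝ, ‖p‖ ≤ 1 → ‖q‖ ≤ 1 →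
      |g t p.1 p.2 - g t q.1 q.2| ≤ K * ‖p - q‖ := by
  obtain ⟨K, hK⟩ := ((isCompact_Icc (a := 0) (b := T)).prod
    (isCompact_closedBall (0 : ℝ × ℝ) 1)).exists_bound_of_continuousOn
      hg.continuous_fderiv.continuousOn
  refine ⟨K, fun t ht p q hp hq => ?_⟩
  exact (convex_closedBall (0 : ℝ × ℝ) 1).norm_image_sub_le_of_norm_fderiv_le (𝕜 := ℝ)
    (f := fun p : ℝ × ℝ => g t p.1 p.2) (fun x _ => hg.differentiable t x)
    (fun x hx => hK (t, x) ⟨ht, hx⟩) (mem_closedBall_zero_iff.2 hq) (mem_closedBall_zero_iff.2 hp)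

theorem abs_sub_sin_sub_le {r x y : ℝ} (hx : |x| ≤ r) (hy : |y| ≤ r) :
    |(x - Real.sin x) - (y - Real.sin y)| ≤ r ^ 2 / 2 * |x - y| := by
  refine (convex_Icc (-r) r).norm_image_sub_le_of_norm_hasDerivWithin_le
    (f := fun x => x - Real.sin x) (f' := fun x => 1 - Real.cos x)
    (fun s _ => ((hasDerivAt_id s).sub (Real.hasDerivAt_sin s)).hasDerivWithinAt) (fun s hs => ?_)
    (abs_le.1 hy) (abs_le.1 hx)
  have h1 := Real.one_sub_sq_div_two_le_cos (x := s)
  have h2 : s ^ 2 ≤ r ^ 2 := sq_le_sq' hs.1 hs.2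
  rw [Real.norm_of_nonneg (by linarith [Real.cos_le_one s])]
  linarith

end Estimates

/-! ### The rescaled pendulum -/

section Pendulum

/-- With `θ = ε u`, the pendulum equation with damping `ε b` reads
`u'' = -a u + ε * rescaledForce a b f g ε t (u, u')`. -/
noncomputable def rescaledForce (a b : ℝ) (f g : ℝ → ℝ → ℝ → ℝ) (ε t : ℝ) (p : ℝ × ℝ) : ℝ :=
  a * (ε * p.1 - Real.sin (ε * p.1)) / ε ^ 2 - b * p.2 + f t (ε * p.1) (ε * p.2) / ε
    + g t (ε * p.1) (ε * p.2)

variable {a b : ℝ} {f g : ℝ → ℝ → ℝ → ℝ}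

theorem continuous_rescaledForce (hf : IsSmoothForcing f) (hg : IsSmoothForcing g) (ε : ℝ) :
    Continuous fun q : ℝ × (ℝ × ℝ) => rescaledForce a b f g ε q.1 q.2 := by
  have hs : Continuous fun q : ℝ × (ℝ × ℝ) => (q.1, ε * q.2.1, ε * q.2.2) := by fun_prop
  have h1 : Continuous fun q : ℝ × (ℝ × ℝ) =>
      a * (ε * q.2.1 - Real.sin (ε * q.2.1)) / ε ^ 2 - b * q.2.2 := by fun_prop
  exact (h1.add ((hf.continuous.comp hs).div_const ε)).add (hg.continuous.comp hs)

theorem rescaledForce_zero (hf0 : ∀ t : ℝ, f t 0 0 = 0) (ε t : ℝ) :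
    rescaledForce a b f g ε t 0 = g t 0 0 := by
  simp [rescaledForce, hf0]

theorem eventually_rescaledForce_sub_le (hf : IsSmoothForcing f) (hg : IsSmoothForcing g)
    {C₁ C₂ : ℝ} (hC₁ : ∀ t : ℝ, deriv (fun x : ℝ => f t x 0) 0 = C₁)
    (hC₂ : ∀ t : ℝ, deriv (fun y : ℝ => f t 0 y) 0 = C₂) (T M : ℝ) {η : ℝ} (hη : 0 < η) :
    ∀ᶠ ε in 𝓝[>] (0 : ℝ), ∀ t ∈ Set.Icc 0 T, ∀ p q : ℝ × ℝ, ‖p‖ ≤ M → ‖q‖ ≤ M →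
      |rescaledForce a b f g ε t p - rescaledForce a b f g ε t q
        - (C₁ * (p.1 - q.1) + (C₂ - b) * (p.2 - q.2))| ≤ η * ‖p - q‖ := by
  obtain ⟨δ, hδ, hfl⟩ := hf.exists_norm_sub_sub_le (T := T) hC₁ hC₂ (half_pos hη)
  obtain ⟨K, hgl⟩ := hg.exists_norm_sub_le (T := T)
  have hsmall : ∀ c : ℝ, Tendsto (fun ε => ε * c) (𝓝[>] (0 : ℝ)) (𝓝 0) := fun c =>
    tendsto_nhdsWithin_of_tendsto_nhds
      ((by fun_prop : Continuous fun ε => ε * c).tendsto' 0 0 (by simp))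
  filter_upwards [(hsmall M).eventually_lt_const hδ, (hsmall M).eventually_lt_const one_pos,
    (hsmall (|a| * M ^ 2 / 2 + K)).eventually_lt_const (half_pos hη), self_mem_nhdsWithin]
    with ε h1 h2 h3 hε t ht p q hp hq
  replace hε : 0 < ε := hε
  have hn : ∀ p : ℝ × ℝ, ‖ε • p‖ = ε * ‖p‖ := fun p => by
    rw [norm_smul, Real.norm_of_nonneg hε.le]
  have hp' : ‖ε • p‖ ≤ ε * M := by rw [hn]; exact mul_le_mul_of_nonneg_left hp hε.le
  have hq' : ‖ε • q‖ ≤ ε * M := by rw [hn]; exact mul_le_mul_of_nonneg_left hq hε.le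
  have hsub : ‖ε • p - ε • q‖ = ε * ‖p - q‖ := by rw [← smul_sub, hn]
  have hF := hfl t ht (ε • p) (ε • q) (hp'.trans_lt h1) (hq'.trans_lt h1)
  have hG := hgl t ht (ε • p) (ε • q) (hp'.trans h2.le) (hq'.trans h2.le)
  have hS := abs_sub_sin_sub_le ((norm_fst_le (ε • p)).trans hp') ((norm_fst_le (ε • q)).trans hq')
  have hS1 : |(ε • p).1 - (ε • q).1| ≤ ε * ‖p - q‖ := by
    rw [← hsub]; exact norm_fst_le (ε • p - ε • q)
  rw [hsub] at hF hG
  simp only [Prod.smul_fst, Prod.smul_snd, smul_eq_mul] at hF hG hS hS1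
  set S := (ε * p.1 - Real.sin (ε * p.1)) - (ε * q.1 - Real.sin (ε * q.1)) with hSdef
  set F := f t (ε * p.1) (ε * p.2) - f t (ε * q.1) (ε * q.2)
    - (C₁ * (ε * p.1 - ε * q.1) + C₂ * (ε * p.2 - ε * q.2)) with hFdef
  have hS' : |a * S / ε ^ 2| ≤ ε * (|a| * M ^ 2 / 2) * ‖p - q‖ := by
    rw [abs_div, abs_mul, abs_of_pos (pow_pos hε 2), div_le_iff₀ (pow_pos hε 2)]
    calc |a| * |S| ≤ |a| * ((ε * M) ^ 2 / 2 * (ε * ‖p - q‖)) := by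
          gcongr; exact hS.trans (by gcongr)
      _ = _ := by ring
  have hF' : |F / ε| ≤ η / 2 * ‖p - q‖ := by
    rw [abs_div, abs_of_pos hε, div_le_iff₀ hε]
    exact hF.trans (le_of_eq (by ring))
  have heq : rescaledForce a b f g ε t p - rescaledForce a b f g ε t q
      - (C₁ * (p.1 - q.1) + (C₂ - b) * (p.2 - q.2)) =
      a * S / ε ^ 2 + F / ε + (g t (ε * p.1) (ε * p.2) - g t (ε * q.1) (ε * q.2)) := by
    simp only [rescaledForce, hSdef, hFdef]
    field_simp
    ring
  rw [heq]
  refine (abs_add_three _ _ _).trans ((add_le_add_three hS' hF' hG).trans ?_)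
  have := mul_le_mul_of_nonneg_right h3.le (norm_nonneg (p - q))
  linarith

end Pendulum

/-! ### Rotating coordinates -/

section Rotating

/-- The unit complex number `e^{iνt}`. -/
noncomputable def phase (ν t : ℝ) : ℂ := Complex.exp (ν * t * Complex.I)

theorem phase_mul_conj (ν t : ℝ) : phase ν t * starRingEnd ℂ (phase ν t) = 1 := by
  rw [Complex.mul_conj, Complex.normSq_eq_norm_sq, phase, ← Complex.ofReal_mul,
    Complex.norm_exp_ofReal_mul_I]
  norm_num

theorem norm_phase (ν t : ℝ) : ‖phase ν t‖ = 1 := by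
  rw [phase, ← Complex.ofReal_mul, Complex.norm_exp_ofReal_mul_I]

theorem continuous_phase (ν : ℝ) : Continuous (phase ν) := by
  unfold phase; fun_prop

theorem periodic_phase {ν : ℝ} (hν : ν ≠ 0) :
    Function.Periodic (phase ν) (2 * Real.pi / ν) := by
  intro t
  have hν' : (ν : ℂ) ≠ 0 := by exact_mod_cast hν
  have : (ν : ℂ) * ((t + 2 * Real.pi / ν : ℝ) : ℂ) * Complex.I =
      ν * t * Complex.I + 2 * Real.pi * Complex.I := by
    push_cast; field_simp
  rw [phase, this, Complex.exp_add, Complex.exp_two_pi_mul_I, mul_one, phase]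

theorem hasDerivAt_conj_phase (ν t : ℝ) :
    HasDerivAt (fun t => starRingEnd ℂ (phase ν t))
      (-(ν * Complex.I) * starRingEnd ℂ (phase ν t)) t := by
  have h : HasDerivAt (phase ν) (phase ν t * (ν * Complex.I)) t := by
    have h0 : HasDerivAt (fun t : ℝ => (ν : ℂ) * (t : ℂ) * Complex.I) (ν * Complex.I) t := by
      simpa using ((Complex.ofRealCLM.hasDerivAt (x := t)).const_mul (ν : ℂ)).mul_const Complex.I
    exact h0.cexp
  have h' := Complex.conjCLE.toContinuousLinearMap.hasFDerivAt.comp_hasDerivAt t h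
  convert! h' using 1
  simp [mul_comm]

theorem integral_phase_sq {ν : ℝ} (hν : ν ≠ 0) :
    ∫ t in (0 : ℝ)..(2 * Real.pi / ν), phase ν t ^ 2 = 0 := by
  have hν' : (ν : ℂ) ≠ 0 := by exact_mod_cast hν
  have hc : (2 * ν * Complex.I : ℂ) ≠ 0 := by simp [hν]
  have h : ∀ t : ℝ, phase ν t ^ 2 = Complex.exp (2 * ν * Complex.I * t) := fun t => by
    rw [phase, ← Complex.exp_nat_mul]; congr 1; push_cast; ring
  have hper : phase ν (2 * Real.pi / ν) = phase ν 0 := by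
    simpa using periodic_phase hν 0
  simp_rw [h]
  rw [integral_exp_mul_complex hc, ← h, ← h, hper, sub_self, zero_div]

/-- The position and velocity `(u, u') = (Re (z e^{-iνt}), ν Im (z e^{-iνt}))` of the harmonic
oscillator `u'' = -ν² u` with complex amplitude `z`. -/
noncomputable def oscillatorState (ν t : ℝ) (z : ℂ) : ℝ × ℝ :=
  ((z * starRingEnd ℂ (phase ν t)).re, ν * (z * starRingEnd ℂ (phase ν t)).im)

theorem oscillatorState_sub (ν t : ℝ) (z z' : ℂ) :
    oscillatorState ν t z - oscillatorState ν t z' = oscillatorState ν t (z - z') := by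
  simp only [oscillatorState, sub_mul, Complex.sub_re, Complex.sub_im, Prod.mk_sub_mk, mul_sub]

theorem norm_oscillatorState_le {ν : ℝ} (hν : 0 ≤ ν) (t : ℝ) (z : ℂ) :
    ‖oscillatorState ν t z‖ ≤ (1 + ν) * ‖z‖ := by
  have hn : ‖z * starRingEnd ℂ (phase ν t)‖ = ‖z‖ := by
    rw [norm_mul, RCLike.norm_conj, norm_phase, mul_one]
  have h1 := Complex.abs_re_le_norm (z * starRingEnd ℂ (phase ν t))
  have h2 := mul_le_mul_of_nonneg_left
    (Complex.abs_im_le_norm (z * starRingEnd ℂ (phase ν t))) hν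
  rw [hn] at h1 h2
  have hz := norm_nonneg z
  refine norm_prod_le_iff.2 ⟨?_, ?_⟩
  · simp only [oscillatorState, Real.norm_eq_abs]
    nlinarith
  · simp only [oscillatorState, Real.norm_eq_abs, abs_mul, abs_of_nonneg hν]
    nlinarith

theorem continuous_oscillatorState (ν : ℝ) :
    Continuous fun q : ℝ × ℂ => oscillatorState ν q.1 q.2 := by
  have h1 : Continuous fun q : ℝ × ℂ => q.2 * starRingEnd ℂ (phase ν q.1) :=
    continuous_snd.mul (Complex.continuous_conj.comp ((continuous_phase ν).comp continuous_fst))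
  exact (Complex.continuous_re.comp h1).prodMk ((Complex.continuous_im.comp h1).const_mul ν)

/-- The linear force `C x + D y` transported to the amplitude `z`: the operator
`z ↦ (i/ν) e^{iνt} (C u + D u')`, in closed form. -/
noncomputable def amplitudeOperator (ν C D t : ℝ) : ℂ →L[ℝ] ℂ :=
  ((D + C / ν * Complex.I) / 2 : ℂ) • ContinuousLinearMap.id ℝ ℂ
    + ((-D + C / ν * Complex.I) / 2 * phase ν t ^ 2 : ℂ) • (Complex.conjCLE : ℂ →L[ℝ] ℂ)

theorem amplitudeOperator_apply {ν : ℝ} (hν : ν ≠ 0) (C D t : ℝ) (z : ℂ) :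
    amplitudeOperator ν C D t z = Complex.I / ν * phase ν t *
      ((C * (oscillatorState ν t z).1 + D * (oscillatorState ν t z).2 : ℝ) : ℂ) := by
  have hν' : (ν : ℂ) ≠ 0 := by exact_mod_cast hν
  have hr := phase_mul_conj ν t
  simp only [amplitudeOperator, oscillatorState, add_apply,
    smul_apply, ContinuousLinearMap.id_apply, smul_eq_mul]
  push_cast
  rw [Complex.re_eq_add_conj, Complex.im_eq_sub_conj, map_mul, Complex.conj_conj]
  simp only [Complex.conjCLE_apply]
  generalize phase ν t = e at *
  field_simp
  linear_combination (-(D * ν * z) - C * Complex.I * z) * hr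

theorem continuous_amplitudeOperator (ν C D : ℝ) : Continuous (amplitudeOperator ν C D) := by
  have := continuous_phase ν
  unfold amplitudeOperator
  fun_prop

theorem integral_amplitudeOperator {ν : ℝ} (hν : ν ≠ 0) (C D : ℝ) (z : ℂ) :
    ∫ t in (0 : ℝ)..(2 * Real.pi / ν), amplitudeOperator ν C D t z =
      (Real.pi / ν * (D + C / ν * Complex.I) : ℂ) * z := by
  have hν' : (ν : ℂ) ≠ 0 := by exact_mod_cast hν
  have hph := continuous_phase ν
  simp only [amplitudeOperator, add_apply,
    smul_apply, ContinuousLinearMap.id_apply, smul_eq_mul]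
  rw [intervalIntegral.integral_add (by simp)
    (Continuous.intervalIntegrable (by fun_prop) _ _), intervalIntegral.integral_mul_const,
    intervalIntegral.integral_mul_const, intervalIntegral.integral_const_mul, integral_phase_sq hν,
    intervalIntegral.integral_const, Complex.real_smul]
  push_cast
  field_simp
  ring

/-- Variation of constants: if the amplitude obeys `z' = (i/ν) e^{iνt} F`, then the state obeys
`u'' = -ν² u + F`. -/
theorem hasDerivAt_oscillatorState {ν : ℝ} (hν : ν ≠ 0) {z : ℝ → ℂ} {F t : ℝ}
    (hz : HasDerivAt z (Complex.I / ν * phase ν t * F) t) :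
    HasDerivAt (fun t => (oscillatorState ν t (z t)).1) (oscillatorState ν t (z t)).2 t ∧
      HasDerivAt (fun t => (oscillatorState ν t (z t)).2)
        (F - ν ^ 2 * (oscillatorState ν t (z t)).1) t := by
  have hν' : (ν : ℂ) ≠ 0 := by exact_mod_cast hν
  have hr := phase_mul_conj ν t
  have h := hz.mul (hasDerivAt_conj_phase ν t)
  have hval : Complex.I / ν * phase ν t * F * starRingEnd ℂ (phase ν t) +
      z t * (-(ν * Complex.I) * starRingEnd ℂ (phase ν t)) =
      ((F / ν : ℝ) : ℂ) * Complex.I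
        - ν * (z t * starRingEnd ℂ (phase ν t)) * Complex.I := by
    push_cast
    linear_combination (Complex.I / ν * F) * hr
  rw [hval] at h
  have hre := Complex.reCLM.hasFDerivAt.comp_hasDerivAt t h
  have him := (Complex.imCLM.hasFDerivAt.comp_hasDerivAt t h).const_mul ν
  constructor
  · convert! hre using 1
    simp [oscillatorState]
  · convert! him using 1
    simp [oscillatorState]
    field_simp

end Rotating

/-! ### Back to the pendulum -/

/-- A solution of the amplitude equation gives the solution `θ = ε u` of the pendulum equation, with
`θ' = ε u'`. -/
theorem isPerturbedPendulumSolution_of_amplitude {a b ε ν : ℝ} {f g : ℝ → ℝ → ℝ → ℝ}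
    (hν : ν ≠ 0) (ha : ν ^ 2 = a) (hε : ε ≠ 0) {z : ℝ → ℂ}
    (hz : ∀ t, HasDerivAt z (ε • (Complex.I / ν * phase ν t *
      (rescaledForce a b f g ε t (oscillatorState ν t (z t)) : ℂ))) t) :
    (∀ t, deriv (fun t => ε * (oscillatorState ν t (z t)).1) t =
        ε * (oscillatorState ν t (z t)).2) ∧
      IsPerturbedPendulumSolution a (ε * b) ε f g
        (fun t => ε * (oscillatorState ν t (z t)).1) := by
  have hd := fun t => hasDerivAt_oscillatorState hν (z := z) (t := t)
    (F := ε * rescaledForce a b f g ε t (oscillatorState ν t (z t))) (by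
      convert! hz t using 1
      rw [Complex.real_smul]; push_cast; ring)
  have h1 := fun t => (hd t).1.const_mul ε
  have hderiv : deriv (fun t => ε * (oscillatorState ν t (z t)).1) =
      fun t => ε * (oscillatorState ν t (z t)).2 := funext fun t => (h1 t).deriv
  refine ⟨fun t => congrFun hderiv t, fun t => (h1 t).differentiableAt, fun t => ?_⟩
  rw [hderiv]
  convert! (hd t).2.const_mul ε using 1
  simp only [rescaledForce, ← ha]
  field_simp
  ring

/-- For all small `ε > 0` the amplitude equation has a periodic solution, bounded uniformly in
`ε`. -/
theorem exists_amplitude_solutions {ν b : ℝ} (hν : 0 < ν) {f g : ℝ → ℝ → ℝ → ℝ}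
    (hf : IsSmoothForcing f) (hg : IsSmoothForcing g)
    (hfper : ∀ t x y : ℝ, f (t + 2 * Real.pi / ν) x y = f t x y)
    (hgper : ∀ t x y : ℝ, g (t + 2 * Real.pi / ν) x y = g t x y)
    (hf0 : ∀ t : ℝ, f t 0 0 = 0) {C₁ C₂ : ℝ}
    (hC₁ : ∀ t : ℝ, deriv (fun x : ℝ => f t x 0) 0 = C₁)
    (hC₂ : ∀ t : ℝ, deriv (fun y : ℝ => f t 0 y) 0 = C₂) (hC : (C₁, C₂) ≠ (0, b)) (a : ℝ) :
    ∃ M : ℝ, ∀ᶠ ε in 𝓝[>] (0 : ℝ), ∃ z : ℝ → ℂ,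
      (∀ t, HasDerivAt z (ε • (Complex.I / ν * phase ν t *
        (rescaledForce a b f g ε t (oscillatorState ν t (z t)) : ℂ))) t) ∧
      Function.Periodic z (2 * Real.pi / ν) ∧ ∀ t, ‖z t‖ ≤ M := by
  have hT : 0 < 2 * Real.pi / ν := by positivity
  have hν' : (ν : ℂ) ≠ 0 := by exact_mod_cast hν.ne'
  -- The averaged linear part is multiplication by a multiple of `(C₂ - b) + i C₁ / ν`, whose
  -- real and imaginary parts vanish together only at the excluded `(C₁, C₂)`.
  have hc : (Real.pi / ν * ((C₂ - b : ℝ) + C₁ / ν * Complex.I) : ℂ) ≠ 0 := by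
    refine mul_ne_zero (div_ne_zero (by exact_mod_cast Real.pi_ne_zero) hν') fun h => hC ?_
    have hre := congrArg Complex.re h
    have him := congrArg Complex.im h
    rw [← Complex.ofReal_div] at hre him
    simp only [Complex.add_re, Complex.ofReal_re, Complex.re_ofReal_mul, Complex.I_re, mul_zero,
      add_zero, Complex.zero_re] at hre
    simp only [Complex.add_im, Complex.ofReal_im, Complex.im_ofReal_mul, Complex.I_im, mul_one,
      zero_add, Complex.zero_im, div_eq_zero_iff, hν.ne', or_false] at him
    rw [him, sub_eq_zero.1 hre]
  let L : ℂ ≃L[ℝ] ℂ :=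
    ((LinearEquiv.smulOfNeZero ℂ ℂ _ hc).restrictScalars ℝ).toContinuousLinearEquiv
  have hgc : Continuous fun t => g t 0 0 :=
    hg.continuous.comp (by fun_prop : Continuous fun t : ℝ => (t, (0 : ℝ), (0 : ℝ)))
  have hph := continuous_phase ν
  obtain ⟨M, hM⟩ := eventually_exists_periodic_solution hT
    (continuous_amplitudeOperator ν C₁ (C₂ - b))
    (h := fun t => Complex.I / ν * phase ν t * (g t 0 0 : ℂ)) (by fun_prop) L
    (fun z => integral_amplitudeOperator hν.ne' C₁ (C₂ - b) z)
  refine ⟨M, hM (fun ε t z => Complex.I / ν * phase ν t *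
    (rescaledForce a b f g ε t (oscillatorState ν t z) : ℂ)) (fun ε => ?_) (fun ε t z => ?_)
    (fun ε t => ?_) fun η hη => ?_⟩
  · have h1 : Continuous fun q : ℝ × ℂ =>
        rescaledForce a b f g ε q.1 (oscillatorState ν q.1 q.2) :=
      (continuous_rescaledForce hf hg ε).comp
        (continuous_fst.prodMk (continuous_oscillatorState ν))
    simp only [Function.uncurry_def]
    fun_prop
  · simp only [oscillatorState, periodic_phase hν.ne' t, rescaledForce, hfper, hgper]
  · have h0 : oscillatorState ν t 0 = 0 := by simp [oscillatorState]
    rw [h0, rescaledForce_zero hf0]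
  · filter_upwards [eventually_rescaledForce_sub_le (a := a) (b := b) hf hg hC₁ hC₂
      (2 * Real.pi / ν) ((1 + ν) * M) (η := η * ν / (1 + ν)) (by positivity)]
      with ε hε t ht z z' hz hz'
    have hstate : ∀ z : ℂ, ‖z‖ ≤ M → ‖oscillatorState ν t z‖ ≤ (1 + ν) * M := fun z hz =>
      (norm_oscillatorState_le hν.le t z).trans (mul_le_mul_of_nonneg_left hz (by positivity))
    have h := hε t ht _ _ (hstate z hz) (hstate z' hz')
    rw [amplitudeOperator_apply hν.ne', ← oscillatorState_sub, ← mul_sub, ← mul_sub,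
      ← Complex.ofReal_sub, ← Complex.ofReal_sub, norm_mul, norm_mul, norm_div, Complex.norm_I,
      norm_phase, Complex.norm_real, Complex.norm_real, Real.norm_of_nonneg hν.le,
      Real.norm_eq_abs, mul_one, Prod.fst_sub, Prod.snd_sub]
    calc _ ≤ 1 / ν * (η * ν / (1 + ν) * ((1 + ν) * ‖z - z'‖)) := by
          refine mul_le_mul_of_nonneg_left (h.trans ?_) (by positivity)
          rw [oscillatorState_sub]
          exact mul_le_mul_of_nonneg_left (norm_oscillatorState_le hν.le t _) (by positivity)
      _ = η * ‖z - z'‖ := by field_simp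

theorem corollary1 (a bbar : ℝ) (ha : 0 < a) (hb : 0 < bbar)
    (f g : ℝ → ℝ → ℝ → ℝ)
    (hf : IsSmoothForcing f) (hg : IsSmoothForcing g)
    (hfper : ∀ t x y : ℝ, f (t + 2 * Real.pi / √a) x y = f t x y)
    (hgper : ∀ t x y : ℝ, g (t + 2 * Real.pi / √a) x y = g t x y)
    (hf0 : ∀ t : ℝ, f t 0 0 = 0)
    (C₁ C₂ V₁ V₂ : ℝ)
    (hC₁ : ∀ t : ℝ, deriv (fun x : ℝ => f t x 0) 0 = C₁)
    (hC₂ : ∀ t : ℝ, deriv (fun y : ℝ => f t 0 y) 0 = C₂)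
    (hV₁ : ∫ t in (0 : ℝ)..(2 * Real.pi / √a), Real.sin (√a * t) * g t 0 0 = V₁)
    (hV₂ : ∫ t in (0 : ℝ)..(2 * Real.pi / √a), Real.cos (√a * t) * g t 0 0 = V₂)
    (hC : (C₁, C₂) ≠ (0, bbar))
    (hV : (V₁, V₂) ≠ (0, 0)) :
    ∃ ε₀ : ℝ, 0 < ε₀ ∧ ∃ θ : ℝ → ℝ → ℝ,
      (∀ ε : ℝ, 0 < ε → ε < ε₀ →
        IsPerturbedPendulumSolution a (ε * bbar) ε f g (θ ε) ∧
          Function.Periodic (θ ε) (2 * Real.pi / √a)) ∧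
      Tendsto (fun ε : ℝ => (θ ε 0, deriv (θ ε) 0)) (𝓝[>] (0 : ℝ)) (𝓝 ((0 : ℝ), (0 : ℝ))) := by
  have hν : 0 < √a := Real.sqrt_pos.2 ha
  obtain ⟨M, hM⟩ := exists_amplitude_solutions hν hf hg hfper hgper hf0 hC₁ hC₂ hC a
  obtain ⟨ε₀, hε₀, hIoo⟩ := mem_nhdsGT_iff_exists_Ioo_subset.1 hM
  choose! z hz hzper hzM using fun ε (hε : ε ∈ Set.Ioo 0 ε₀) => hIoo hε
  have hsol := fun ε (hε : ε ∈ Set.Ioo 0 ε₀) =>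
    isPerturbedPendulumSolution_of_amplitude hν.ne' (Real.sq_sqrt ha.le) hε.1.ne' (hz ε hε)
  refine ⟨ε₀, hε₀, fun ε t => ε * (oscillatorState (√a) t (z ε t)).1,
    fun ε h0 h1 => ⟨(hsol ε ⟨h0, h1⟩).2, fun t => ?_⟩, ?_⟩
  · simp only [oscillatorState, periodic_phase hν.ne' t, hzper ε ⟨h0, h1⟩ t]
  · have hlim : Tendsto (fun ε => ε * ((1 + √a) * M)) (𝓝[>] (0 : ℝ)) (𝓝 0) :=
      tendsto_nhdsWithin_of_tendsto_nhds
        ((by fun_prop : Continuous fun ε => ε * ((1 + √a) * M)).tendsto' 0 0 (by simp))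
    refine squeeze_zero_norm' ?_ hlim
    filter_upwards [Ioo_mem_nhdsGT hε₀] with ε hε
    rw [(hsol ε hε).1 0]
    change ‖ε • oscillatorState (√a) 0 (z ε 0)‖ ≤ _
    rw [norm_smul, Real.norm_of_nonneg hε.1.le]
    exact mul_le_mul_of_nonneg_left ((norm_oscillatorState_le hν.le 0 _).trans
      (mul_le_mul_of_nonneg_left (hzM ε hε 0) (by positivity))) hε.1.le
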